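/- Let $0<q<1$ and $\alpha>-1$. Write $(a;q)_n=\prod_{k=0}^{n-1}(1-aq^k)$, $(a;q)_\infty=\prod_{k\ge 0}(1-aq^k)$, $[n]_q=\frac{1-q^n}{1-q}$, $[n]_q!=\prod_{k=1}^n[k]_q$, and $E_q(z)=\sum_{n\ge 0}\frac{q^{n(n-1)/2}}{(q;q)_n}(z(1-q))^n$. Let $$J^{(2)}_\alpha(z;q)=\frac{(q^{\alpha+1};q)_\infty}{(q;q)_\infty}\sum_{n\ge 0}(-1)^n\frac{q^{n(\alpha+n)}(z/2)^{2n+\alpha}}{(q;q)_n(q^{\alpha+1};q)_n}$$ be the second Jackson $q$-Bessel function, let $\mathcal J^{(2)}_\alpha(z;q)=\frac{(q;q)_\infty}{(q^{\alpha+1};q)_\infty}(z/2)^{-\alpha}J^{(2)}_\alpha(z;q)$ (an entire function of $z$), let $g^{(2)}_\alpha(t;q)=\mathcal J^{(2)}_\alpha(t(1-q);q^2)$, and let $j^{(2)}_{1,\alpha}$ be the smallest positive zero of $J^{(2)}_\alpha(\cdot;q^2)$. The generalized $q$-Bernoulli polynomials $B^{(2)}_{n,\alpha}(z;q)$ are defined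 by $$\frac{E_q(zt)\,E_q(-t/2)}{g^{(2)}_\alpha(it;q)}=\sum_{n\ge 0}B^{(2)}_{n,\alpha}(z;q)\frac{t^n}{[n]_q!}$$ near $t=0$. Let $f(z)=\sum_{n\ge0}f_nz^n$ $(z\in\mathbb C)$ satisfy $$\limsup_{n\to\infty}\left|\frac{f_n}{\Psi_n}\right|^{1/n}=\tau,\qquad \Psi_n=\frac{q^{n(n-1)/2}}{[n]_q!},\qquad 0\le\tau<\min\left\{\frac{2}{1-q},\frac{j^{(2)}_{1,\alpha}}{1-q}\right\}.$$ Then for every $n\ge 0$ the series $$L_n(f)=(1-q)^{-n}\sum_{k=n}^{\infty}f_k\,\frac{q^{-k(k-1)/2}(q;q)_k\,(q^{2\alpha+1};q^2)_{k-n}\,(1/2)^{k-n}}{(q;q)_{k-n}\,(q^{2\alpha+1};q)_{k-n}}$$ converges absolutely, and for every $z\in\mathbb C$ $$f(z)=\sum_{n=0}^{\infty}L_n(f)\,\frac{B^{(2)}_{n,\alpha}(z;q)}{[n]_q!},$$ where the series converges absolutely. For $\alpha=-\tfrac12$ the quotient $(q^{2\alpha+1};q^2)_m/(q^{2\alpha+1};q)_m$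 is read as its limit as $\alpha\to-\tfrac12$, namely $1$ for $m=0$ and $(-q;q)_{m-1}$ for $m\ge1$. -/

import Mathlib

open Filter Topology

noncomputable section

namespace QBernoulli

/-- The finite `q`-shifted factorial `(a;q)_n = ∏_{k<n} (1 - a q^k)`. -/
def qPoch (a q : ℝ) (n : ℕ) : ℝ := ∏ k ∈ Finset.range n, (1 - a * q ^ k)

/-- The infinite `q`-shifted factorial `(a;q)_∞ = ∏_{k≥0} (1 - a q^k)` (for `0 < q < 1`). -/
def qPochInf (a q : ℝ) : ℝ := ∏' k : ℕ, (1 - a * q ^ k)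

/-- The `q`-natural number `[n]_q = (1 - q^n) / (1 - q)`. -/
def qNat (q : ℝ) (n : ℕ) : ℝ := (1 - q ^ n) / (1 - q)

/-- The `q`-factorial `[n]_q! = [1]_q [2]_q ⋯ [n]_q`. -/
def qFact (q : ℝ) (n : ℕ) : ℝ := ∏ k ∈ Finset.range n, qNat q (k + 1)

/-- Jackson's `q`-exponential function
`E_q(z) = ∑ q^{n(n-1)/2} (z(1-q))^n / (q;q)_n`, an entire function of `z`. -/
def bigEq (q : ℝ) (z : ℂ) : ℂ :=
  ∑' n : ℕ, ((q ^ (n * (n - 1) / 2) / qPoch q q n : ℝ) : ℂ) * (z * (1 - (q : ℂ))) ^ n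

/-- The second Jackson `q`-Bessel function `J_α^{(2)}(z;q)` (principal branch of the power). -/
def besselJ2 (α q : ℝ) (z : ℂ) : ℂ :=
  ((qPochInf (q ^ (α + 1)) q / qPochInf q q : ℝ) : ℂ) *
    ∑' n : ℕ, (-1 : ℂ) ^ n *
      ((q ^ ((n : ℝ) * (α + n)) / (qPoch q q n * qPoch (q ^ (α + 1)) q n) : ℝ) : ℂ) *
      (z / 2) ^ (2 * (n : ℂ) + (α : ℂ))

/-- The modified second Jackson `q`-Bessel function
`𝒥_α^{(2)}(z;q) = (q;q)_∞ / (q^{α+1};q)_∞ (z/2)^{-α} J_α^{(2)}(z;q)`, given by its power series,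
so that the removable singularity at `z = 0` is removed; it is an entire function of `z`.
The lemma `besselJ2_eq` below is the stated relation with `J_α^{(2)}`. -/
def modBesselJ2 (α q : ℝ) (z : ℂ) : ℂ :=
  ∑' n : ℕ, (-1 : ℂ) ^ n *
    ((q ^ ((n : ℝ) * (α + n)) / (qPoch q q n * qPoch (q ^ (α + 1)) q n) : ℝ) : ℂ) *
    (z / 2) ^ (2 * n)

theorem besselJ2_eq (α q : ℝ) {z : ℂ} (hz : z ≠ 0) :
    besselJ2 α q z =
      ((qPochInf (q ^ (α + 1)) q / qPochInf q q : ℝ) : ℂ) * (z / 2) ^ (α : ℂ) *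
        modBesselJ2 α q z := by
  have h2 : z / 2 ≠ 0 := div_ne_zero hz two_ne_zero
  unfold besselJ2 modBesselJ2
  rw [mul_assoc]
  refine congrArg _ ?_
  rw [← tsum_mul_left]
  refine tsum_congr fun n => ?_
  have : (z / 2) ^ (2 * (n : ℂ) + (α : ℂ)) = (z / 2) ^ (α : ℂ) * (z / 2) ^ (2 * n) := by
    rw [Complex.cpow_add _ _ h2, mul_comm]
    congr 1
    exact_mod_cast Complex.cpow_natCast (z / 2) (2 * n)
  rw [this]
  ring

/-- The function `g_α^{(2)}(t;q) = 𝒥_α^{(2)}(t(1-q);q²)`. -/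
def g2 (α q : ℝ) (t : ℂ) : ℂ := modBesselJ2 α (q ^ 2) (t * (1 - (q : ℂ)))

/-- The generating function `E_q(zt) E_q(-t/2) / g_α^{(2)}(it;q)` of the generalized
`q`-Bernoulli polynomials of the second kind, as a function of `t`. -/
def genFun (α q : ℝ) (z t : ℂ) : ℂ :=
  bigEq q (z * t) * bigEq q (-t / 2) / g2 α q (Complex.I * t)

/-- The generalized `q`-Bernoulli polynomials `B_{n,α}^{(2)}(z;q)`, defined by
`E_q(zt) E_q(-t/2) / g_α^{(2)}(it;q) = ∑ B_{n,α}^{(2)}(z;q) t^n / [n]_q!`, that is,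
`B_{n,α}^{(2)}(z;q) / [n]_q!` is the `n`-th Taylor coefficient at `t = 0`. -/
def bernoulliB2 (α q : ℝ) (n : ℕ) (z : ℂ) : ℂ :=
  (qFact q n : ℂ) * (iteratedDeriv n (genFun α q z) 0 / (n.factorial : ℂ))

/-- `j` is the smallest positive zero of `J_α^{(2)}(·;q²)`. -/
def IsFirstZero (α q j : ℝ) : Prop :=
  IsLeast {x : ℝ | 0 < x ∧ besselJ2 α (q ^ 2) (x : ℂ) = 0} j

/-- `Ψ_n = q^{n(n-1)/2} / [n]_q!`. -/
def Psi (q : ℝ) (n : ℕ) : ℝ := q ^ (n * (n - 1) / 2) / qFact q n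

/-- The quotient `(q^{2α+1};q²)_m / (q^{2α+1};q)_m`. At `α = -1/2`, where it is formally `0/0` for
`m ≥ 1`, it stands for its limit as `α → -1/2`, which is `(-q;q)_{m-1}` for `m ≥ 1`
(and `1` for `m = 0`); see `pochRatio_continuousAt`. -/
def pochRatio (α q : ℝ) (m : ℕ) : ℝ :=
  if α = -1 / 2 then (if m = 0 then 1 else qPoch (-q) q (m - 1))
  else qPoch (q ^ (2 * α + 1)) (q ^ 2) m / qPoch (q ^ (2 * α + 1)) q m

theorem pochRatio_continuousAt {q : ℝ} (hq0 : 0 < q) (hq1 : q < 1) (m : ℕ) :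
    ContinuousAt (fun α => pochRatio α q m) (-1 / 2) := by
  rcases m with _ | m
  · have : (fun α => pochRatio α q 0) = fun _ => 1 := by
      funext α
      simp [pochRatio, qPoch]
    rw [this]
    exact continuousAt_const
  · have hpos : ∀ k : ℕ, (1 - q ^ (k + 1)) ≠ 0 := fun k =>
      (sub_pos.2 (pow_lt_one₀ hq0.le hq1 (Nat.succ_ne_zero k))).ne'
    have key : (fun α => pochRatio α q (m + 1)) = fun α =>
        (∏ k ∈ Finset.range m, (1 - q ^ (2 * α + 1) * (q ^ 2) ^ (k + 1))) /
          ∏ k ∈ Finset.range m, (1 - q ^ (2 * α + 1) * q ^ (k + 1)) := by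
      funext α
      by_cases h : α = -1 / 2
      · subst h
        have h0 : (2 * (-1 / 2 : ℝ) + 1) = 0 := by norm_num
        simp only [pochRatio, if_true, h0, Real.rpow_zero, qPoch, Nat.succ_ne_zero, if_false,
          Nat.add_sub_cancel]
        rw [← Finset.prod_div_distrib]
        refine Finset.prod_congr rfl fun k _ => ?_
        rw [one_mul, one_mul, eq_div_iff (hpos k)]
        ring
      · have hne : (1 - q ^ (2 * α + 1)) ≠ 0 := by
          intro h1
          have h2 : q ^ (2 * α + 1) = q ^ (0 : ℝ) := by rw [Real.rpow_zero]; linarith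
          have h3 := (Real.rpow_right_inj hq0 hq1.ne).1 h2
          exact h (by linarith)
        simp only [pochRatio, if_neg h, qPoch]
        rw [Finset.prod_range_succ', Finset.prod_range_succ']
        simp only [pow_zero, mul_one]
        rw [mul_div_mul_right _ _ hne]
    rw [key]
    have hc : ContinuousAt (fun α : ℝ => q ^ (2 * α + 1)) (-1 / 2) :=
      ContinuousAt.rpow continuousAt_const (by fun_prop) (Or.inl hq0.ne')
    refine ContinuousAt.div ?_ ?_ ?_
    · exact tendsto_finsetProd _ fun k _ => (continuousAt_const.sub (hc.mul continuousAt_const))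
    · exact tendsto_finsetProd _ fun k _ => (continuousAt_const.sub (hc.mul continuousAt_const))
    · rw [Finset.prod_ne_zero_iff]
      intro k _
      have h0 : (2 * (-1 / 2 : ℝ) + 1) = 0 := by norm_num
      rw [h0, Real.rpow_zero, one_mul]
      exact hpos k

/-- The `k`-th term of the series that defines the coefficient `L_n(f)` (used for `k ≥ n`), where
`a k` is the `k`-th Taylor coefficient of `f`. -/
def coeffTerm (α q : ℝ) (a : ℕ → ℂ) (n k : ℕ) : ℂ :=
  a k * (((q ^ (k * (k - 1) / 2))⁻¹ * qPoch q q k * pochRatio α q (k - n) *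
    (1 / 2) ^ (k - n) / qPoch q q (k - n) : ℝ) : ℂ)

/-- The coefficient
`L_n(f) = (1-q)^{-n} ∑_{k ≥ n} f_k q^{-k(k-1)/2} (q;q)_k (q^{2α+1};q²)_{k-n} (1/2)^{k-n} /
  ((q;q)_{k-n} (q^{2α+1};q)_{k-n})`. -/
def coeffL (α q : ℝ) (a : ℕ → ℂ) (n : ℕ) : ℂ :=
  (((1 - q) ^ n)⁻¹ : ℝ) * ∑' k : Set.Ici n, coeffTerm α q a n k

end QBernoulli

end

/-!
Write `g(t)` for `g_α^{(2)}(t;q)`, and let `D(t) = ∑ dₘ tᵐ` with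
`dₘ = ((1-q)/2)ᵐ (q^{2α+1};q²)_m / ((q;q)_m (q^{2α+1};q)_m)`, a series of radius of convergence at
least `2/(1-q)`. Both factors of `E_q(-t/2) D(t)` satisfy a `q`-difference equation in `t`, and the
resulting equation for the product forces `E_q(-t/2) D(t) = g(it)`. Hence `D` times the generating
function is `E_q(zt)`, and comparing coefficients gives
`Ψ_k zᵏ = ∑_{n+m=k} B_{n,α}^{(2)}(z;q) / [n]_q! · dₘ`. Multiplying by `f_k / Ψ_k` and summing over
`k` yields the expansion of `f`, with `L_n(f) = ∑ₘ f_{n+m} / Ψ_{n+m} · dₘ`.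

The rearrangement of the double series is justified by choosing `ρ` strictly between `τ` and both
radii of convergence. The radius of the generating function is that of `1/g(it)`, so one needs that
`g(it)` has no complex zero of modulus below `j/(1-q)`, although `j` is only the first real zero of
the `q`-Bessel function. In the variable `X = z²/4`, the reciprocal of the normalised `q`-Bessel
function has nonnegative Taylor coefficients, because its contiguity relation in `α` expands it into
Stieltjes continued fractions; by Pringsheim's argument the zeros of least modulus then include a
positive one.
-/

namespace QBernoulli

open PowerSeries
open scoped ENNReal

theorem enorm_lt_ofReal_iff {E : Type*} [SeminormedAddGroup E] {x : E} {r : ℝ} :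
    ‖x‖ₑ < ENNReal.ofReal r ↔ ‖x‖ < r := by
  rw [← ofReal_norm, ENNReal.ofReal_lt_ofReal_iff_of_nonneg (norm_nonneg x)]

section SumsTo

variable {𝕜 : Type*} [RCLike 𝕜]

/-- The function `t ↦ ∑ cₙ tⁿ` attached to a formal power series `P = ∑ cₙ Xⁿ`; it has the junk
value `0` wherever the series diverges. -/
noncomputable def powerSum (P : 𝕜⟦X⟧) (t : 𝕜) : 𝕜 := ∑' n, coeff n P * t ^ n

/-- The formal power series `P` converges to the function `F` on the open disc of radius `R`
around `0`. Unlike `HasFPowerSeriesOnBall`, this is tied to the ring structure of `𝕜⟦X⟧`, so that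
products of functions correspond to products of series. The radius `⊤` expresses that `F` is
entire. -/
def SumsTo (P : 𝕜⟦X⟧) (F : 𝕜 → 𝕜) (R : ℝ≥0∞) : Prop :=
  ∀ t, ‖t‖ₑ < R → HasSum (fun n => coeff n P * t ^ n) (F t)

namespace SumsTo

variable {P Q : 𝕜⟦X⟧} {F G : 𝕜 → 𝕜} {R R' : ℝ≥0∞}

theorem mono (h : SumsTo P F R) (hR : R' ≤ R) : SumsTo P F R' :=
  fun t ht => h t (ht.trans_le hR)

theorem congr (h : SumsTo P F R) (hFG : ∀ t, ‖t‖ₑ < R → F t = G t) : SumsTo P G R :=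
  fun t ht => hFG t ht ▸ h t ht

theorem to_powerSum (h : SumsTo P F R) : SumsTo P (powerSum P) R :=
  fun t ht => (h t ht).summable.hasSum

theorem one : SumsTo (1 : 𝕜⟦X⟧) (fun _ => 1) R := fun t _ => by
  simpa using hasSum_single (f := fun n => coeff n (1 : 𝕜⟦X⟧) * t ^ n) 0 fun n hn => by
    simp [coeff_one, hn]

theorem mul (hP : SumsTo P F R) (hQ : SumsTo Q G R) : SumsTo (P * Q) (fun t => F t * G t) R := by
  intro t ht
  have hPt := (hP t ht).summable.norm
  have hQt := (hQ t ht).summable.norm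
  have hcauchy := (summable_norm_sum_mul_antidiagonal_of_summable_norm hPt hQt).of_norm.hasSum
  rw [← tsum_mul_tsum_eq_tsum_sum_antidiagonal_of_summable_norm hPt hQt, (hP t ht).tsum_eq,
    (hQ t ht).tsum_eq] at hcauchy
  refine hcauchy.congr_fun fun n => ?_
  rw [coeff_mul, Finset.sum_mul]
  refine Finset.sum_congr rfl fun x hx => ?_
  rw [← Finset.HasAntidiagonal.mem_antidiagonal.1 hx, pow_add]
  ring

theorem rescale (h : SumsTo P F R) (c : 𝕜) :
    SumsTo (rescale c P) (fun t => F (c * t)) (R / ‖c‖ₑ) := by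
  intro t ht
  have hct : ‖c * t‖ₑ < R := by
    rw [enorm_mul]
    exact ENNReal.mul_lt_of_lt_div' ht
  refine (h _ hct).congr_fun fun n => ?_
  rw [coeff_rescale, mul_pow]
  ring

theorem rescale_top (h : SumsTo P F ⊤) (c : 𝕜) :
    SumsTo (PowerSeries.rescale c P) (fun t => F (c * t)) ⊤ := by
  simpa only [ENNReal.top_div_of_ne_top enorm_ne_top] using h.rescale c

theorem expand (h : SumsTo P F ⊤) {p : ℕ} (hp : p ≠ 0) :
    SumsTo (expand p hp P) (fun t => F (t ^ p)) ⊤ := by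
  intro t _
  refine (mul_right_injective₀ hp).hasSum_iff (fun n hn => ?_) |>.1 ?_
  · rw [coeff_expand_of_not_dvd _ hp, zero_mul]
    exact fun ⟨m, hm⟩ => hn ⟨m, hm.symm⟩
  · refine (h (t ^ p) enorm_lt_top).congr_fun fun n => ?_
    rw [Function.comp_apply, coeff_expand_mul, pow_mul]

theorem summable_norm_mul_pow (h : SumsTo P F R) {r : ℝ} (hr0 : 0 ≤ r)
    (hr : ENNReal.ofReal r < R) : Summable fun n => ‖coeff n P‖ * r ^ n := by
  have hr' : ‖(r : 𝕜)‖ₑ < R := by simpa [← ofReal_norm, abs_of_nonneg hr0] using hr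
  simpa [abs_of_nonneg hr0] using (h _ hr').summable.norm

theorem hasFPowerSeriesOnBall (h : SumsTo P F R) (hR : 0 < R) :
    HasFPowerSeriesOnBall F (FormalMultilinearSeries.ofScalars 𝕜 fun n => coeff n P) 0 R where
  r_le := ENNReal.le_of_forall_nnreal_lt fun r hr =>
    FormalMultilinearSeries.le_radius_of_summable _ <| by
      simpa only [FormalMultilinearSeries.ofScalars_norm] using
        h.summable_norm_mul_pow r.coe_nonneg (by simpa using hr)
  r_pos := hR
  hasSum {t} ht := by
    simpa [FormalMultilinearSeries.ofScalars_apply_eq, mul_comm] using h t (by simpa using ht)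

theorem unique (hP : SumsTo P F R) (hQ : SumsTo Q F R) (hR : 0 < R) : P = Q := by
  have heq := (hP.hasFPowerSeriesOnBall hR).hasFPowerSeriesAt.eq_formalMultilinearSeries
    (hQ.hasFPowerSeriesOnBall hR).hasFPowerSeriesAt
  ext n
  exact congrFun (FormalMultilinearSeries.ofScalars_series_injective 𝕜 𝕜 heq) n

theorem differentiable (h : SumsTo P F ⊤) : Differentiable 𝕜 F := by
  simpa [Metric.eball_top, differentiableOn_univ] using
    (h.hasFPowerSeriesOnBall ENNReal.zero_lt_top).differentiableOn

theorem apply_zero (h : SumsTo P F R) (hR : 0 < R) : F 0 = constantCoeff P := by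
  refine (h 0 (by simpa using hR)).unique ?_
  simpa using hasSum_single (f := fun n => coeff n P * (0 : 𝕜) ^ n) 0 fun n hn => by simp [hn]

theorem of_ratio {ρ : ℕ → 𝕜} {l : 𝕜}
    (hP : ∀ᶠ n in atTop, coeff (n + 1) P = ρ n * coeff n P) (hρ : Tendsto ρ atTop (𝓝 l)) :
    SumsTo P (powerSum P) ‖l‖ₑ⁻¹ := by
  intro t ht
  have hlt : ‖l‖ * ‖t‖ < 1 := by
    rw [← norm_mul, ← ENNReal.ofReal_lt_one, ofReal_norm, enorm_mul]
    exact ENNReal.mul_lt_of_lt_div' (by simpa using ht)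
  obtain ⟨r, hr, hr1⟩ := exists_between hlt
  refine (summable_of_ratio_norm_eventually_le hr1 ?_).hasSum
  filter_upwards [hP, (hρ.norm.mul_const ‖t‖).eventually (gt_mem_nhds hr)] with n hn hrn
  calc ‖coeff (n + 1) P * t ^ (n + 1)‖
      = ‖ρ n‖ * ‖t‖ * ‖coeff n P * t ^ n‖ := by simp only [hn, pow_succ, norm_mul]; ring
    _ ≤ r * ‖coeff n P * t ^ n‖ := by gcongr

theorem of_ratio_zero {ρ : ℕ → 𝕜} (hP : ∀ n, coeff (n + 1) P = ρ n * coeff n P)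
    (hρ : Tendsto ρ atTop (𝓝 0)) : SumsTo P (powerSum P) ⊤ := by
  simpa using of_ratio (Eventually.of_forall hP) hρ

theorem of_differentiableOn {F : ℂ → ℂ} (hF : DifferentiableOn ℂ F (Metric.eball 0 R)) :
    SumsTo (PowerSeries.mk fun n => iteratedDeriv n F 0 / (n.factorial : ℂ)) F R := by
  intro t ht
  refine (Complex.hasSum_taylorSeries_on_eball hF (z := t) (by simpa using ht)).congr_fun
    fun n => ?_
  simp only [coeff_mk, smul_eq_mul, sub_zero]
  ring

theorem inv {P : ℂ⟦X⟧} {F : ℂ → ℂ} (h : SumsTo P F ⊤) (hP : constantCoeff P ≠ 0) (hR : 0 < R)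
    (hF : ∀ t, ‖t‖ₑ < R → F t ≠ 0) : SumsTo P⁻¹ (fun t => (F t)⁻¹) R := by
  have htaylor : SumsTo _ (fun t => (F t)⁻¹) R :=
    of_differentiableOn <| h.differentiable.differentiableOn.inv fun t ht =>
      hF t (by simpa [Metric.mem_eball] using ht)
  have hprod := ((h.mono le_top).mul htaylor).congr fun t ht => mul_inv_cancel₀ (hF t ht)
  rwa [(PowerSeries.eq_inv_iff_mul_eq_one hP).2 ((mul_comm _ _).trans (hprod.unique one hR))]
    at htaylor

theorem norm_le_norm_apply_norm {P : ℝ⟦X⟧} {F : ℂ → ℂ} (h : SumsTo (P.map Complex.ofRealHom) F R)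
    (hP : ∀ n, 0 ≤ coeff n P) {t : ℂ} (ht : ‖t‖ₑ < R) : ‖F t‖ ≤ ‖F ‖t‖‖ := by
  have hre : HasSum (fun n => coeff n P * ‖t‖ ^ n) (F ‖t‖).re := by
    have := Complex.hasSum_re (h ‖t‖ (by simpa [enorm_eq_nnnorm] using ht))
    refine this.congr_fun fun n => ?_
    simp [← Complex.ofReal_pow]
  refine ((h t ht).norm_le_of_bounded hre fun n => ?_).trans (Complex.re_le_norm _)
  simp [abs_of_nonneg (hP n)]

end SumsTo

end SumsTo

section ContinuedFraction

variable {K : Type*} [Field K] [LinearOrder K] [IsStrictOrderedRing K]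
  {u : ℕ → K⟦X⟧} {c : ℕ → K}

theorem coeff_mul_nonneg {P Q : K⟦X⟧} (hP : ∀ n, 0 ≤ coeff n P) (hQ : ∀ n, 0 ≤ coeff n Q) (n : ℕ) :
    0 ≤ coeff n (P * Q) := by
  rw [coeff_mul]
  exact Finset.sum_nonneg fun x _ => mul_nonneg (hP _) (hQ _)

/-- The quotients `rₖ = uₖ₊₁ / uₖ` satisfy `rₖ = 1 + cₖ X rₖ rₖ₊₁`: they are Stieltjes continued
fractions. -/
theorem coeff_succ_mul_inv_nonneg (hc : ∀ k, 0 ≤ c k) (hu : ∀ k, constantCoeff (u k) = 1)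
    (hrec : ∀ k, u k = u (k + 1) - C (c k) * X * u (k + 2)) (k n : ℕ) :
    0 ≤ coeff n (u (k + 1) * (u k)⁻¹) := by
  have hinv : ∀ k, u k * (u k)⁻¹ = 1 := fun k =>
    PowerSeries.mul_inv_cancel _ (by rw [hu]; exact one_ne_zero)
  have hr : ∀ k, u (k + 1) * (u k)⁻¹ =
      1 + C (c k) * (X * ((u (k + 1) * (u k)⁻¹) * (u (k + 2) * (u (k + 1))⁻¹))) := fun k => by
    linear_combination (-(u k)⁻¹) * hrec k + hinv k -
      C (c k) * X * (u k)⁻¹ * u (k + 2) * hinv (k + 1)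
  induction n using Nat.strong_induction_on generalizing k with
  | _ n ih =>
    rw [hr]
    rcases n with _ | n
    · simp
    · rw [map_add, coeff_C_mul, coeff_succ_X_mul, coeff_mul, coeff_one, if_neg n.succ_ne_zero,
        zero_add]
      refine mul_nonneg (hc k) (Finset.sum_nonneg fun x hx => ?_)
      have := Finset.HasAntidiagonal.mem_antidiagonal.1 hx
      exact mul_nonneg (ih _ (by lia) k) (ih _ (by lia) (k + 1))

theorem coeff_mul_inv_zero_nonneg (hc : ∀ k, 0 ≤ c k) (hu : ∀ k, constantCoeff (u k) = 1)
    (hrec : ∀ k, u k = u (k + 1) - C (c k) * X * u (k + 2)) (k n : ℕ) :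
    0 ≤ coeff n (u k * (u 0)⁻¹) := by
  have hinv : ∀ k, u k * (u k)⁻¹ = 1 := fun k =>
    PowerSeries.mul_inv_cancel _ (by rw [hu]; exact one_ne_zero)
  induction k generalizing n with
  | zero =>
    rw [hinv, coeff_one]
    split_ifs <;> simp
  | succ k ih =>
    rw [show u (k + 1) * (u 0)⁻¹ = u (k + 1) * (u k)⁻¹ * (u k * (u 0)⁻¹) by
      linear_combination -(u (k + 1) * (u 0)⁻¹) * hinv k]
    exact coeff_mul_nonneg (coeff_succ_mul_inv_nonneg hc hu hrec k) ih n

open scoped PowerSeries.WithPiTopology in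
theorem coeff_inv_nonneg_of_three_term [TopologicalSpace K] [OrderTopology K]
    (hc : ∀ k, 0 ≤ c k) (hu : ∀ k, constantCoeff (u k) = 1)
    (hrec : ∀ k, u k = u (k + 1) - C (c k) * X * u (k + 2)) (hlim : Tendsto u atTop (𝓝 1))
    (n : ℕ) : 0 ≤ coeff n (u 0)⁻¹ := by
  have htends : Tendsto (fun k => coeff n (u k * (u 0)⁻¹)) atTop (𝓝 (coeff n (u 0)⁻¹)) := by
    simpa [Function.comp_def] using
      ((WithPiTopology.continuous_coeff K n).tendsto _).comp (hlim.mul_const (u 0)⁻¹)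
  exact ge_of_tendsto' htends fun k => coeff_mul_inv_zero_nonneg hc hu hrec k n

end ContinuedFraction

theorem exists_zero_of_minimal_norm {E F : Type*} [SeminormedAddCommGroup E] [ProperSpace E]
    [TopologicalSpace F] [T1Space F] [Zero F] {h : E → F} (hh : Continuous h) {w : E}
    (hw : h w = 0) : ∃ w₀, h w₀ = 0 ∧ ‖w₀‖ ≤ ‖w‖ ∧ ∀ z, ‖z‖ < ‖w₀‖ → h z ≠ 0 := by
  have hclosed : IsClosed (h ⁻¹' {0}) := isClosed_singleton.preimage hh
  obtain ⟨w₀, hw₀, hdist⟩ := hclosed.exists_infDist_eq_dist ⟨w, hw⟩ 0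
  have hmin : ∀ z, h z = 0 → ‖w₀‖ ≤ ‖z‖ := fun z hz => by
    simpa [hdist] using Metric.infDist_le_dist_of_mem (x := 0) (show z ∈ h ⁻¹' {0} from hz)
  exact ⟨w₀, hw₀, hmin w hw, fun z hz hz0 => (hmin z hz0).not_gt hz⟩

/-- Pringsheim's argument: nonnegativity of the Taylor coefficients of `1 / h` gives
`|h(|z|)| ≤ |h(z)|` up to and including the first circle on which `h` has a zero, so a zero on that
circle forces a positive one. -/
theorem ne_zero_of_coeff_inv_nonneg {P : ℝ⟦X⟧} (hP0 : constantCoeff P ≠ 0)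
    (hP : ∀ n, 0 ≤ coeff n P⁻¹) {h : ℂ → ℂ} (hh : SumsTo (P.map Complex.ofRealHom) h ⊤) {W : ℝ}
    (hpos : ∀ x : ℝ, 0 < x → x < W → h x ≠ 0) {w : ℂ} (hw : ‖w‖ < W) : h w ≠ 0 := by
  intro hw0
  have hPmap : constantCoeff (P.map Complex.ofRealHom) ≠ 0 := by
    rw [← coeff_zero_eq_constantCoeff_apply, coeff_map, coeff_zero_eq_constantCoeff_apply]
    simpa using hP0
  have hcont : Continuous h := hh.differentiable.continuous
  obtain ⟨w₀, hw₀, hle, hne⟩ := exists_zero_of_minimal_norm hcont hw0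
  have hw₀pos : 0 < ‖w₀‖ := norm_pos_iff.2 fun h0 => by
    rw [h0, hh.apply_zero ENNReal.zero_lt_top] at hw₀
    exact hPmap hw₀
  have henorm : ∀ z : ℂ, ‖z‖ₑ < ‖w₀‖ₑ ↔ ‖z‖ < ‖w₀‖ := fun z => by
    rw [← ofReal_norm w₀, enorm_lt_ofReal_iff]
  have hinv : SumsTo (P⁻¹.map Complex.ofRealHom) (fun z => (h z)⁻¹) ‖w₀‖ₑ := by
    have hmap : P⁻¹.map Complex.ofRealHom = (P.map Complex.ofRealHom)⁻¹ :=
      (PowerSeries.eq_inv_iff_mul_eq_one hPmap).2 (by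
        rw [← map_mul, PowerSeries.inv_mul_cancel _ hP0, map_one])
    exact hmap ▸ hh.inv hPmap (by simpa using hw₀pos.ne') fun z hz =>
      hne z ((henorm z).1 hz)
  have hball : ∀ z ∈ Metric.ball (0 : ℂ) ‖w₀‖, ‖h ‖z‖‖ ≤ ‖h z‖ := fun z hz => by
    have hz : ‖z‖ < ‖w₀‖ := by simpa using hz
    have := hinv.norm_le_norm_apply_norm hP (t := z) ((henorm z).2 hz)
    rw [norm_inv, norm_inv] at this
    exact (inv_le_inv₀ (norm_pos_iff.2 (hne z hz)) (norm_pos_iff.2 (hne _ (by simpa using hz)))).1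
      this
  have hw₀mem : w₀ ∈ closure (Metric.ball (0 : ℂ) ‖w₀‖) := by
    rw [closure_ball _ hw₀pos.ne']
    simp
  have hbound := le_on_closure hball (by fun_prop) (by fun_prop) hw₀mem
  exact hpos ‖w₀‖ hw₀pos (hle.trans_lt hw) (by simpa [hw₀] using hbound)

section Rearrangement

theorem exists_norm_le_of_limsup_lt {E : Type*} [SeminormedAddCommGroup E] {x : ℕ → E} {ρ : ℝ}
    (hρ : 0 < ρ)
    (h : limsup (fun n : ℕ => ENNReal.ofReal (‖x n‖ ^ (1 / (n : ℝ)))) atTop < ENNReal.ofReal ρ) :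
    ∃ C, ∀ n, ‖x n‖ ≤ C * ρ ^ n := by
  have hO : x =O[atTop] fun n : ℕ => ρ ^ n := by
    refine Asymptotics.IsBigO.of_bound 1 ?_
    filter_upwards [eventually_lt_of_limsup_lt h, eventually_ne_atTop 0] with n hn hn0
    rw [ENNReal.ofReal_lt_ofReal_iff hρ, one_div] at hn
    rw [one_mul, Real.norm_of_nonneg (by positivity),
      ← Real.rpow_inv_natCast_pow (norm_nonneg (x n)) hn0]
    exact pow_le_pow_left₀ (by positivity) hn.le n
  obtain ⟨C, -, hC⟩ := Asymptotics.bound_of_isBigO_nat_atTop hO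
  refine ⟨C, fun n => (hC (pow_pos hρ n).ne').trans_eq ?_⟩
  rw [Real.norm_of_nonneg (by positivity)]

theorem hasSum_Ici_iff {A : Type*} [AddCommMonoid A] [TopologicalSpace A] {f : ℕ → A} {n : ℕ}
    {s : A} : HasSum (fun k : Set.Ici n => f k) s ↔ HasSum (fun m => f (n + m)) s := by
  have hrange : Set.range (n + ·) = Set.Ici n := by
    ext k
    exact ⟨fun ⟨m, hm⟩ => hm ▸ Nat.le_add_right n m, fun hk => ⟨k - n, Nat.add_sub_of_le hk⟩⟩
  rw [← hrange]
  exact (add_right_injective n).hasSum_range_iff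

theorem hasSum_sum_antidiagonal {A : Type*} [AddCommMonoid A] [TopologicalSpace A]
    [ContinuousAdd A] [RegularSpace A] {T : ℕ × ℕ → A} {s : A} (hT : HasSum T s) :
    HasSum (fun k => ∑ y ∈ Finset.HasAntidiagonal.antidiagonal k, T y) s := by
  refine ((Finset.HasAntidiagonal.sigmaAntidiagonalEquivProd.hasSum_iff.2 hT).sigma
    fun k => hasSum_fintype _).congr_fun fun k => ?_
  exact (Finset.sum_coe_sort _ T).symm

variable {A : Type*} [NormedRing A] [CompleteSpace A] {x d b : ℕ → A} {ρ C : ℝ}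

theorem summable_add_mul (hx : ∀ n, ‖x n‖ ≤ C * ρ ^ n) (hd : Summable fun m => ‖d m‖ * ρ ^ m)
    (n : ℕ) : Summable fun m => x (n + m) * d m := by
  refine Summable.of_norm_bounded (hd.mul_left (C * ρ ^ n)) fun m => ?_
  calc ‖x (n + m) * d m‖ ≤ ‖x (n + m)‖ * ‖d m‖ := norm_mul_le _ _
    _ ≤ C * ρ ^ (n + m) * ‖d m‖ := by gcongr; exact hx _
    _ = C * ρ ^ n * (‖d m‖ * ρ ^ m) := by ring

theorem summable_add_mul_mul (hρ : 0 ≤ ρ) (hx : ∀ n, ‖x n‖ ≤ C * ρ ^ n)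
    (hd : Summable fun m => ‖d m‖ * ρ ^ m) (hb : Summable fun n => ‖b n‖ * ρ ^ n) :
    Summable fun y : ℕ × ℕ => x (y.1 + y.2) * d y.2 * b y.1 := by
  have hbd : Summable fun y : ℕ × ℕ => (‖b y.1‖ * ρ ^ y.1) * (‖d y.2‖ * ρ ^ y.2) :=
    hb.mul_of_nonneg hd (fun n => by positivity) fun m => by positivity
  refine Summable.of_norm_bounded (hbd.mul_left C) fun y => ?_
  calc ‖x (y.1 + y.2) * d y.2 * b y.1‖ ≤ ‖x (y.1 + y.2)‖ * ‖d y.2‖ * ‖b y.1‖ := norm_mul₃_le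
    _ ≤ C * ρ ^ (y.1 + y.2) * ‖d y.2‖ * ‖b y.1‖ := by gcongr; exact hx _
    _ = C * ((‖b y.1‖ * ρ ^ y.1) * (‖d y.2‖ * ρ ^ y.2)) := by ring

theorem hasSum_tsum_add_mul {A : Type*} [NormedCommRing A] [CompleteSpace A] {x : ℕ → A}
    {B D : A⟦X⟧} (hρ : 0 ≤ ρ) (hx : ∀ n, ‖x n‖ ≤ C * ρ ^ n)
    (hD : Summable fun m => ‖coeff m D‖ * ρ ^ m)
    (hB : Summable fun n => ‖coeff n B‖ * ρ ^ n) {s : A}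
    (hs : HasSum (fun k => x k * coeff k (B * D)) s) :
    HasSum (fun n => (∑' m, x (n + m) * coeff m D) * coeff n B) s := by
  have hT := summable_add_mul_mul hρ hx hD hB
  have hrows := hT.hasSum.prod_fiberwise fun n =>
    (summable_add_mul hx hD n).hasSum.mul_right (coeff n B)
  have hdiag : HasSum (fun k => x k * coeff k (B * D)) _ :=
    (hasSum_sum_antidiagonal hT.hasSum).congr_fun fun k => by
      rw [coeff_mul, Finset.mul_sum]
      refine Finset.sum_congr rfl fun y hy => ?_
      rw [Finset.HasAntidiagonal.mem_antidiagonal.1 hy]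
      ring
  rwa [hdiag.unique hs] at hrows

end Rearrangement

section QFactorial

variable {a q : ℝ}

theorem qPoch_succ (a q : ℝ) (n : ℕ) : qPoch a q (n + 1) = qPoch a q n * (1 - a * q ^ n) :=
  Finset.prod_range_succ _ _

theorem qPoch_succ' (a q : ℝ) (n : ℕ) : qPoch a q (n + 1) = (1 - a) * qPoch (a * q) q n := by
  unfold qPoch
  rw [Finset.prod_range_succ', mul_comm, pow_zero, mul_one]
  refine congrArg _ (Finset.prod_congr rfl fun k _ => ?_)
  ring

theorem one_sub_mul_pow_pos (ha : a < 1) (hq0 : 0 < q) (hq1 : q < 1) (n : ℕ) :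
    0 < 1 - a * q ^ n := by
  refine sub_pos.2 ?_
  rcases le_or_gt a 0 with h | h
  · exact (mul_nonpos_of_nonpos_of_nonneg h (by positivity)).trans_lt one_pos
  · exact (mul_le_of_le_one_right h.le (pow_le_one₀ hq0.le hq1.le)).trans_lt ha

theorem qPoch_pos (ha : a < 1) (hq0 : 0 < q) (hq1 : q < 1) (n : ℕ) : 0 < qPoch a q n :=
  Finset.prod_pos fun k _ => one_sub_mul_pow_pos ha hq0 hq1 k

theorem one_sub_pow_succ_pos (hq0 : 0 < q) (hq1 : q < 1) (n : ℕ) : 0 < 1 - q ^ (n + 1) :=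
  sub_pos.2 (pow_lt_one₀ hq0.le hq1 n.succ_ne_zero)

theorem qFact_eq (q : ℝ) (n : ℕ) : qFact q n = qPoch q q n / (1 - q) ^ n := by
  unfold qFact qPoch qNat
  rw [Finset.prod_div_distrib, Finset.prod_const, Finset.card_range]
  refine congrArg (· / _) (Finset.prod_congr rfl fun k _ => ?_)
  ring

theorem triangle_succ (k : ℕ) : (k + 1) * (k + 1 - 1) / 2 = k * (k - 1) / 2 + k := by
  rw [← Nat.choose_two_right, ← Nat.choose_two_right, Nat.choose_succ_succ' k 1,
    Nat.choose_one_right, add_comm]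

theorem mul_pred_succ (k : ℕ) : (k + 1) * (k + 1 - 1) = k * (k - 1) + 2 * k := by
  rcases k with _ | k
  · rfl
  · simp only [Nat.add_sub_cancel]
    ring

theorem tendsto_comp_pow {Y : Type*} [TopologicalSpace Y] {f : ℝ → Y} (hf : ContinuousAt f 0)
    (hq0 : 0 < q) (hq1 : q < 1) : Tendsto (fun n : ℕ => f (q ^ n)) atTop (𝓝 (f 0)) :=
  hf.tendsto.comp (tendsto_pow_atTop_nhds_zero_of_lt_one hq0.le hq1)

end QFactorial

/-- The power series `∑ (-1)ⁿ p^{n(n-1)} cⁿ / ((p;p)_n (c;p)_n) Xⁿ`. For `c = p^{α+1}` it is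
`𝒥_α^{(2)}(z;p)` in the variable `X = z² / 4`. -/
noncomputable def besselSeries (p c : ℝ) : ℝ⟦X⟧ :=
  PowerSeries.mk fun n =>
    (-1) ^ n * (p ^ (n * (n - 1)) * c ^ n / (qPoch p p n * qPoch c p n))

section Bessel

variable {p c : ℝ}

theorem constantCoeff_besselSeries (p c : ℝ) : constantCoeff (besselSeries p c) = 1 := by
  rw [← coeff_zero_eq_constantCoeff_apply]
  simp [besselSeries, qPoch]

theorem coeff_succ_besselSeries (p c : ℝ) (n : ℕ) :
    coeff (n + 1) (besselSeries p c) =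
      -(p ^ (2 * n) * c / ((1 - p ^ (n + 1)) * (1 - c * p ^ n))) *
        coeff n (besselSeries p c) := by
  simp only [besselSeries, coeff_mk, qPoch_succ, mul_pred_succ, div_eq_mul_inv, mul_inv]
  ring

theorem besselSeries_zero (p : ℝ) : besselSeries p 0 = 1 := by
  ext n
  rcases n with _ | n <;> simp [besselSeries, qPoch, coeff_one]

theorem besselSeries_three_term (hp0 : 0 < p) (hp1 : p < 1) (hc0 : 0 < c) (hc1 : c < 1) :
    besselSeries p c = besselSeries p (c * p) -
      C (c / ((1 - c) * (1 - c * p))) * X * besselSeries p (c * p * p) := by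
  have hcp : c * p < 1 := (mul_lt_of_lt_one_right hc0 hp1).trans hc1
  ext n
  rcases n with _ | n
  · simp [besselSeries, qPoch, mul_assoc]
  have hc : 1 - c ≠ 0 := (sub_pos.2 hc1).ne'
  have hcp' : 1 - c * p ≠ 0 := (sub_pos.2 hcp).ne'
  have hpn : 1 - p ^ (n + 1) ≠ 0 := (one_sub_pow_succ_pos hp0 hp1 n).ne'
  have hP : qPoch p p n ≠ 0 := (qPoch_pos hp1 hp0 hp1 n).ne'
  have hD : qPoch (c * p) p n ≠ 0 := (qPoch_pos hcp hp0 hp1 n).ne'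
  have hE : 1 - c * p ^ (n + 1) ≠ 0 := (one_sub_mul_pow_pos hc1 hp0 hp1 (n + 1)).ne'
  have hshift : qPoch (c * p * p) p n =
      qPoch (c * p) p n * (1 - c * p ^ (n + 1)) / (1 - c * p) := by
    rw [eq_div_iff hcp', mul_comm, ← qPoch_succ', qPoch_succ, pow_succ', mul_assoc]
  rw [map_sub, mul_assoc, coeff_C_mul, coeff_succ_X_mul]
  simp only [besselSeries, coeff_mk]
  rw [qPoch_succ' c, qPoch_succ' (c * p), hshift, qPoch_succ p, ← pow_succ', mul_pred_succ,
    pow_add p, pow_mul' p, pow_succ c, mul_pow c p (n + 1), pow_succ c, mul_pow, mul_pow]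
  generalize p ^ (n + 1) = x at *
  field_simp
  ring

theorem coeff_inv_besselSeries_nonneg (hp0 : 0 < p) (hp1 : p < 1) (hc0 : 0 < c) (hc1 : c < 1)
    (n : ℕ) : 0 ≤ coeff n (besselSeries p c)⁻¹ := by
  have hcp : ∀ k : ℕ, c * p ^ k < 1 := fun k => sub_pos.1 (one_sub_mul_pow_pos hc1 hp0 hp1 k)
  have hlim : ∀ m, ContinuousAt (fun x : ℝ => coeff m (besselSeries p (c * x))) 0 := fun m => by
    simp only [besselSeries, coeff_mk]
    refine continuousAt_const.mul (ContinuousAt.div (by fun_prop) ?_ ?_)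
    · unfold qPoch
      fun_prop
    · simpa [qPoch] using (qPoch_pos hp1 hp0 hp1 m).ne'
  have h := coeff_inv_nonneg_of_three_term (u := fun k => besselSeries p (c * p ^ k))
    (c := fun k => c * p ^ k / ((1 - c * p ^ k) * (1 - c * p ^ (k + 1)))) (n := n)
    (fun k => div_nonneg (by positivity)
      (mul_nonneg (sub_pos.2 (hcp k)).le (sub_pos.2 (hcp (k + 1))).le))
    (fun k => constantCoeff_besselSeries _ _)
    (fun k => by
      simpa only [pow_succ, ← mul_assoc] using
        besselSeries_three_term hp0 hp1 (mul_pos hc0 (pow_pos hp0 k)) (hcp k))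
    ((WithPiTopology.tendsto_iff_coeff_tendsto _ _ _ _).2 fun m => by
      simpa [besselSeries_zero] using tendsto_comp_pow (hlim m) hp0 hp1)
  simpa using h

theorem sumsTo_besselSeries (hp0 : 0 < p) (hp1 : p < 1) (c : ℝ) :
    SumsTo ((besselSeries p c).map Complex.ofRealHom)
      (powerSum ((besselSeries p c).map Complex.ofRealHom)) ⊤ := by
  have hρ : ContinuousAt
      (fun x : ℝ => ((-(x ^ 2 * c / ((1 - x * p) * (1 - c * x))) : ℝ) : ℂ)) 0 := by
    have h : ((1 - (0 : ℝ) * p) * (1 - c * 0)) ≠ 0 := by simp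
    fun_prop (disch := exact h)
  refine SumsTo.of_ratio_zero (fun n => ?_) (by simpa using tendsto_comp_pow hρ hp0 hp1)
  rw [coeff_map, coeff_succ_besselSeries, map_mul, coeff_map, pow_mul', pow_succ p]
  simp

theorem modBesselJ2_eq_powerSum (hp0 : 0 < p) (α : ℝ) (z : ℂ) :
    modBesselJ2 α p z =
      powerSum ((besselSeries p (p ^ (α + 1))).map Complex.ofRealHom) ((z / 2) ^ 2) := by
  have hpow : ∀ n : ℕ, p ^ ((n : ℝ) * (α + n)) = p ^ (n * (n - 1)) * (p ^ (α + 1)) ^ n := by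
    intro n
    rw [← Real.rpow_natCast, ← Real.rpow_natCast (p ^ (α + 1)), ← Real.rpow_mul hp0.le,
      ← Real.rpow_add hp0]
    congr 1
    rcases n with _ | n
    · simp
    · simp only [Nat.add_sub_cancel]
      push_cast
      ring
  refine tsum_congr fun n => ?_
  rw [hpow, besselSeries, coeff_map, coeff_mk, pow_mul (z / 2)]
  simp

end Bessel

section EulerProduct

variable {q A : ℝ} {φ : ℕ → ℝ}

/-- Euler's power series of the infinite product `(X;q)_∞ = ∏ (1 - X qᵏ)`. -/
noncomputable def eulerSeries (q : ℝ) : ℝ⟦X⟧ :=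
  PowerSeries.mk fun k => (-1) ^ k * (q ^ (k * (k - 1) / 2) / qPoch q q k)

theorem constantCoeff_rescale {R : Type*} [CommSemiring R] (a : R) (P : R⟦X⟧) :
    constantCoeff (rescale a P) = constantCoeff P := by
  rw [← coeff_zero_eq_constantCoeff_apply, coeff_rescale, pow_zero, one_mul,
    coeff_zero_eq_constantCoeff_apply]

theorem eulerSeries_eq_mul_rescale (hq0 : 0 < q) (hq1 : q < 1) :
    eulerSeries q = (1 - X) * rescale q (eulerSeries q) := by
  ext n
  rcases n with _ | n
  · simp [sub_mul, constantCoeff_rescale]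
  · rw [sub_mul, one_mul, map_sub, coeff_succ_X_mul, coeff_rescale, coeff_rescale]
    have hP := (qPoch_pos hq1 hq0 hq1 n).ne'
    have hn := (one_sub_pow_succ_pos hq0 hq1 n).ne'
    simp only [eulerSeries, coeff_mk, qPoch_succ, triangle_succ, ← pow_succ']
    field_simp
    ring

theorem qDifference_mk (hφ : ∀ m, φ (m + 1) * ((1 - q ^ (m + 1)) * (1 - A * q ^ m)) =
      (1 - A * q ^ (2 * m)) * φ m) :
    C q * (1 - X) * mk φ - C (q + A) * rescale q (mk φ) +
      C A * (1 + C q * X) * rescale q (rescale q (mk φ)) = 0 := by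
  ext m
  rcases m with _ | m
  · simp [sub_mul, add_mul, mul_assoc, constantCoeff_rescale]
  · simp only [sub_mul, add_mul, one_mul, mul_assoc, map_sub, map_add, coeff_C_mul,
      coeff_succ_X_mul, coeff_rescale, coeff_mk, map_zero]
    linear_combination q * hφ m

theorem qDifference_eulerSeries_mul (hq0 : 0 < q) (hq1 : q < 1)
    (hφ : ∀ m, φ (m + 1) * ((1 - q ^ (m + 1)) * (1 - A * q ^ m)) =
      (1 - A * q ^ (2 * m)) * φ m) :
    C q * (eulerSeries q * mk φ) - C (q + A) * rescale q (eulerSeries q * mk φ) +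
      C A * ((1 - C (q ^ 2) * X ^ 2) * rescale q (rescale q (eulerSeries q * mk φ))) = 0 := by
  have heuler := eulerSeries_eq_mul_rescale hq0 hq1
  have heuler' := congrArg (rescale q) heuler
  rw [map_mul, map_sub, map_one, rescale_X] at heuler'
  simp only [map_mul, map_pow]
  linear_combination C q * mk φ * heuler + rescale q (eulerSeries q) * qDifference_mk hφ -
    C A * (1 + C q * X) * rescale q (rescale q (mk φ)) * heuler'

theorem coeff_add_two_eulerSeries_mul (hq0 : 0 < q) (hq1 : q < 1)
    (hφ : ∀ m, φ (m + 1) * ((1 - q ^ (m + 1)) * (1 - A * q ^ m)) =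
      (1 - A * q ^ (2 * m)) * φ m) (n : ℕ) :
    coeff (n + 2) (eulerSeries q * mk φ) * ((1 - q ^ (n + 2)) * (1 - A * q ^ (n + 1))) =
      A * q ^ (2 * n + 1) * coeff n (eulerSeries q * mk φ) := by
  have h := congrArg (coeff (n + 2)) (qDifference_eulerSeries_mul hq0 hq1 hφ)
  rw [map_add, map_sub, coeff_C_mul, coeff_C_mul] at h
  simp only [map_sub, sub_mul, one_mul, mul_assoc, coeff_C_mul, coeff_rescale, map_zero,
    coeff_X_pow_mul] at h
  refine mul_left_cancel₀ hq0.ne' ?_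
  linear_combination h

theorem eulerSeries_mul_mk_eq_expand (hq0 : 0 < q) (hq1 : q < 1) (hA : A * q < 1)
    (hφ0 : φ 0 = 1) (hφ1 : φ 1 = 1 / (1 - q))
    (hφ : ∀ m, φ (m + 1) * ((1 - q ^ (m + 1)) * (1 - A * q ^ m)) =
      (1 - A * q ^ (2 * m)) * φ m) :
    eulerSeries q * mk φ =
      expand 2 two_ne_zero (rescale (-1) (besselSeries (q ^ 2) (A * q))) := by
  have hrec := coeff_add_two_eulerSeries_mul hq0 hq1 hφ
  have hq : ∀ n, 1 - q ^ (n + 2) ≠ 0 := fun n => (one_sub_pow_succ_pos hq0 hq1 (n + 1)).ne'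
  have hAq : ∀ n, 1 - A * q ^ (n + 1) ≠ 0 := fun n => by
    simpa [pow_succ', mul_assoc] using (one_sub_mul_pow_pos hA hq0 hq1 n).ne'
  ext n
  obtain ⟨k, rfl | rfl⟩ := n.even_or_odd'
  · rw [coeff_expand_mul, coeff_rescale]
    induction k with
    | zero => simp [besselSeries, eulerSeries, qPoch, hφ0, coeff_mul]
    | succ k ih =>
      refine mul_right_cancel₀ (mul_ne_zero (hq (2 * k)) (hAq (2 * k)))
        ((hrec (2 * k)).trans ?_)
      rw [ih, coeff_succ_besselSeries, ← pow_mul, ← pow_mul, ← pow_mul, mul_assoc A q,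
        ← pow_succ', mul_add_one 2 k]
      have := hq (2 * k)
      have := hAq (2 * k)
      field_simp
      ring
  · rw [coeff_expand_of_not_dvd _ _ _ (by lia)]
    induction k with
    | zero =>
      rw [coeff_mul, Finset.Nat.sum_antidiagonal_succ]
      simp [eulerSeries, qPoch, hφ0, hφ1]
    | succ k ih =>
      have h := hrec (2 * k + 1)
      rw [ih, mul_zero] at h
      exact (mul_eq_zero.1 h).resolve_right (mul_ne_zero (hq _) (hAq _))

end EulerProduct

/-- The coefficients `(q^{2α+1};q²)_m / ((q^{2α+1};q)_m (q;q)_m)` of the series of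
`g_α^{(2)}(it;q) / E_q(-t/2)` in the variable `(1-q)t/2`. -/
noncomputable def expansionCoeff (α q : ℝ) (m : ℕ) : ℝ := pochRatio α q m / qPoch q q m

section ExpansionCoeff

variable {α q : ℝ}

theorem one_sub_rpow_mul_pow_ne_zero (hq0 : 0 < q) (hq1 : q < 1) (hα : -1 < α)
    (hα' : α ≠ -1 / 2) (m : ℕ) : 1 - q ^ (2 * α + 1) * q ^ m ≠ 0 := by
  have hexp : 2 * α + 1 + m ≠ 0 := by
    rcases m with _ | m
    · exact fun h => hα' (by push_cast at h; linarith)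
    · push_cast
      linarith [m.cast_nonneg (α := ℝ)]
  rw [← Real.rpow_natCast, ← Real.rpow_add hq0, sub_ne_zero]
  exact fun h => hexp ((Real.rpow_right_inj hq0 hq1.ne).1 (h.symm.trans (Real.rpow_zero q).symm))

theorem pochRatio_zero (α q : ℝ) : pochRatio α q 0 = 1 := by
  simp [pochRatio, qPoch]

theorem pochRatio_one (hq0 : 0 < q) (hq1 : q < 1) (hα : -1 < α) : pochRatio α q 1 = 1 := by
  by_cases hα' : α = -1 / 2
  · simp [pochRatio, hα', qPoch]
  · have := one_sub_rpow_mul_pow_ne_zero hq0 hq1 hα hα' 0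
    rw [pow_zero, mul_one] at this
    simp [pochRatio, hα', qPoch, this]

theorem pochRatio_succ (hq0 : 0 < q) (hq1 : q < 1) (hα : -1 < α) (m : ℕ) :
    pochRatio α q (m + 1) * (1 - q ^ (2 * α + 1) * q ^ m) =
      (1 - q ^ (2 * α + 1) * q ^ (2 * m)) * pochRatio α q m := by
  by_cases hα' : α = -1 / 2
  · have hA : q ^ (2 * α + 1) = 1 := by
      rw [hα']
      norm_num
    rw [hA]
    rcases m with _ | m
    · simp
    · simp only [pochRatio, if_pos hα', Nat.succ_ne_zero, if_false, Nat.add_sub_cancel, qPoch_succ]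
      ring
  · have hm := one_sub_rpow_mul_pow_ne_zero hq0 hq1 hα hα' m
    simp only [pochRatio, if_neg hα', qPoch_succ, ← pow_mul]
    rw [mul_div_mul_comm, mul_assoc, div_mul_cancel₀ _ hm, mul_comm]

theorem expansionCoeff_succ (hq0 : 0 < q) (hq1 : q < 1) (hα : -1 < α) (m : ℕ) :
    expansionCoeff α q (m + 1) *
        ((1 - q ^ (m + 1)) * (1 - q ^ (2 * α + 1) * q ^ m)) =
      (1 - q ^ (2 * α + 1) * q ^ (2 * m)) * expansionCoeff α q m := by
  have hm := (one_sub_pow_succ_pos hq0 hq1 m).ne'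
  unfold expansionCoeff
  rw [qPoch_succ, ← pow_succ', mul_div_assoc', ← pochRatio_succ hq0 hq1 hα]
  field_simp

theorem sq_rpow_add_one (hq0 : 0 < q) (α : ℝ) : (q ^ 2) ^ (α + 1) = q ^ (2 * α + 1) * q := by
  rw [← Real.rpow_add_one hq0.ne', ← Real.rpow_natCast, ← Real.rpow_mul hq0.le]
  congr 1
  push_cast
  ring

theorem sq_rpow_add_one_lt_one (hq0 : 0 < q) (hq1 : q < 1) (hα : -1 < α) :
    (q ^ 2) ^ (α + 1) < 1 :=
  Real.rpow_lt_one (by positivity) (pow_lt_one₀ hq0.le hq1 two_ne_zero) (by linarith)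

theorem eulerSeries_mul_expansionCoeff (hq0 : 0 < q) (hq1 : q < 1) (hα : -1 < α) :
    eulerSeries q * mk (expansionCoeff α q) =
      expand 2 two_ne_zero (rescale (-1) (besselSeries (q ^ 2) ((q ^ 2) ^ (α + 1)))) := by
  rw [sq_rpow_add_one hq0]
  refine eulerSeries_mul_mk_eq_expand hq0 hq1 ?_ ?_ ?_ (expansionCoeff_succ hq0 hq1 hα)
  · rw [← sq_rpow_add_one hq0]
    exact sq_rpow_add_one_lt_one hq0 hq1 hα
  · simp [expansionCoeff, pochRatio_zero, qPoch]
  · simp [expansionCoeff, pochRatio_one hq0 hq1 hα, qPoch]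

end ExpansionCoeff

section GeneratingFunction

variable {α q j : ℝ}

theorem modBesselJ2_ne_zero (hq0 : 0 < q) (hq1 : q < 1) (hα : -1 < α) (hj : IsFirstZero α q j)
    {z : ℂ} (hz : ‖z‖ < j) : modBesselJ2 α (q ^ 2) z ≠ 0 := by
  have hp0 : 0 < q ^ 2 := by positivity
  have hp1 : q ^ 2 < 1 := pow_lt_one₀ hq0.le hq1 two_ne_zero
  have hj0 : 0 < j := hj.1.1
  rw [modBesselJ2_eq_powerSum hp0]
  refine ne_zero_of_coeff_inv_nonneg (W := (j / 2) ^ 2)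
    (by simp [constantCoeff_besselSeries])
    (coeff_inv_besselSeries_nonneg hp0 hp1 (by positivity) (sq_rpow_add_one_lt_one hq0 hq1 hα))
    (sumsTo_besselSeries hp0 hp1 _) (fun x hx0 hxW hx => ?_) ?_
  · have hlt : 2 * √x < j := by
      have := (Real.sqrt_lt' (by positivity)).2 hxW
      linarith
    have hpos : 0 < 2 * √x := by positivity
    have hsq : (((2 * √x : ℝ) : ℂ) / 2) ^ 2 = x := by
      push_cast
      rw [mul_div_cancel_left₀ _ two_ne_zero, ← Complex.ofReal_pow, Real.sq_sqrt hx0.le]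
    have hzero : besselJ2 α (q ^ 2) ((2 * √x : ℝ) : ℂ) = 0 := by
      rw [besselJ2_eq α (q ^ 2) (Complex.ofReal_ne_zero.2 hpos.ne'), modBesselJ2_eq_powerSum hp0,
        hsq, hx, mul_zero]
    exact (hj.2 ⟨hpos, hzero⟩).not_gt hlt
  · rw [norm_pow, norm_div, Complex.norm_two]
    gcongr

theorem norm_one_sub_ofReal (hq1 : q < 1) : ‖1 - (q : ℂ)‖ = 1 - q := by
  rw [← Complex.ofReal_one, ← Complex.ofReal_sub, Complex.norm_of_nonneg (sub_pos.2 hq1).le]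

theorem g2_ne_zero (hq0 : 0 < q) (hq1 : q < 1) (hα : -1 < α) (hj : IsFirstZero α q j) {t : ℂ}
    (ht : ‖t‖ < j / (1 - q)) : g2 α q (Complex.I * t) ≠ 0 := by
  refine modBesselJ2_ne_zero hq0 hq1 hα hj ?_
  rw [norm_mul, norm_mul, Complex.norm_I, one_mul, norm_one_sub_ofReal hq1]
  exact (lt_div_iff₀ (sub_pos.2 hq1)).1 ht

theorem Psi_eq (q : ℝ) (n : ℕ) :
    Psi q n = q ^ (n * (n - 1) / 2) / qPoch q q n * (1 - q) ^ n := by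
  rw [Psi, qFact_eq, div_div_eq_mul_div, mul_div_right_comm]

theorem Psi_pos (hq0 : 0 < q) (hq1 : q < 1) (n : ℕ) : 0 < Psi q n := by
  rw [Psi_eq]
  have := qPoch_pos hq1 hq0 hq1 n
  have := sub_pos.2 hq1
  positivity

theorem Psi_succ (q : ℝ) (n : ℕ) :
    Psi q (n + 1) = q ^ n * (1 - q) / (1 - q ^ n * q) * Psi q n := by
  simp only [Psi_eq, triangle_succ, qPoch_succ, div_eq_mul_inv, mul_inv, mul_comm q]
  ring

theorem sumsTo_bigEq (hq0 : 0 < q) (hq1 : q < 1) :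
    SumsTo ((mk (Psi q)).map Complex.ofRealHom) (bigEq q) ⊤ := by
  have hρ : ContinuousAt (fun x : ℝ => ((x * (1 - q) / (1 - x * q) : ℝ) : ℂ)) 0 := by
    have h : 1 - 0 * q ≠ 0 := by simp
    fun_prop (disch := exact h)
  refine (SumsTo.of_ratio_zero (fun n => ?_) (by simpa using tendsto_comp_pow hρ hq0 hq1)).congr
    fun t _ => tsum_congr fun n => ?_
  · rw [coeff_map, coeff_mk, Psi_succ, map_mul, coeff_map, coeff_mk]
    simp
  · simp only [coeff_map, coeff_mk, Psi_eq, Complex.ofRealHom_eq_coe, mul_pow]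
    push_cast
    ring

theorem rescale_mk_Psi (q : ℝ) :
    rescale (-1 / 2 : ℂ) ((mk (Psi q)).map Complex.ofRealHom) =
      rescale ((1 - (q : ℂ)) / 2) ((eulerSeries q).map Complex.ofRealHom) := by
  ext n
  simp only [coeff_rescale, coeff_map, coeff_mk, eulerSeries, Psi_eq, Complex.ofRealHom_eq_coe,
    div_pow]
  push_cast
  ring

/-- The power series of `g_α^{(2)}(it;q) / E_q(-t/2)` in `t`. -/
noncomputable def quotientSeries (α q : ℝ) : ℂ⟦X⟧ :=
  rescale ((1 - (q : ℂ)) / 2) ((mk (expansionCoeff α q)).map Complex.ofRealHom)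

theorem rescale_mk_Psi_mul_quotientSeries (hq0 : 0 < q) (hq1 : q < 1) (hα : -1 < α) :
    rescale (-1 / 2 : ℂ) ((mk (Psi q)).map Complex.ofRealHom) * quotientSeries α q =
      rescale ((1 - (q : ℂ)) / 2) ((expand 2 two_ne_zero
        (rescale (-1) (besselSeries (q ^ 2) ((q ^ 2) ^ (α + 1))))).map Complex.ofRealHom) := by
  rw [rescale_mk_Psi, quotientSeries, ← map_mul, ← map_mul,
    eulerSeries_mul_expansionCoeff hq0 hq1 hα]

theorem expansionCoeff_succ_eventually (hq0 : 0 < q) (hq1 : q < 1) (hα : -1 < α) :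
    ∀ᶠ n in atTop, expansionCoeff α q (n + 1) =
      (1 - q ^ (2 * α + 1) * (q ^ n) ^ 2) / ((1 - q ^ n * q) * (1 - q ^ (2 * α + 1) * q ^ n)) *
        expansionCoeff α q n := by
  have hA : ContinuousAt (fun x : ℝ => 1 - q ^ (2 * α + 1) * x) 0 := by fun_prop
  have hA0 : 1 - q ^ (2 * α + 1) * 0 ≠ 0 := by simp
  filter_upwards [(tendsto_comp_pow hA hq0 hq1).eventually_ne hA0] with n hn
  have hqn := (one_sub_pow_succ_pos hq0 hq1 n).ne'
  rw [← pow_succ, div_mul_eq_mul_div, eq_div_iff (mul_ne_zero hqn hn),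
    expansionCoeff_succ hq0 hq1 hα, ← pow_mul']

theorem sumsTo_quotientSeries (hq0 : 0 < q) (hq1 : q < 1) (hα : -1 < α) :
    SumsTo (quotientSeries α q) (powerSum (quotientSeries α q)) (ENNReal.ofReal (2 / (1 - q))) := by
  have hρ : ContinuousAt (fun x : ℝ => (((1 - q ^ (2 * α + 1) * x ^ 2) /
      ((1 - x * q) * (1 - q ^ (2 * α + 1) * x)) : ℝ) : ℂ)) 0 := by
    have h : (1 - 0 * q) * (1 - q ^ (2 * α + 1) * 0) ≠ 0 := by simp
    fun_prop (disch := exact h)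
  have hsum : SumsTo ((mk (expansionCoeff α q)).map Complex.ofRealHom) _ _ :=
    SumsTo.of_ratio (by
      filter_upwards [expansionCoeff_succ_eventually hq0 hq1 hα] with n hn
      rw [coeff_map, coeff_mk, hn, map_mul, coeff_map, coeff_mk]
      rfl) (tendsto_comp_pow hρ hq0 hq1)
  refine (hsum.rescale ((1 - (q : ℂ)) / 2)).to_powerSum.mono (le_of_eq ?_)
  have := sub_pos.2 hq1
  rw [← ofReal_norm ((1 - (q : ℂ)) / 2), norm_div, norm_one_sub_ofReal hq1, Complex.norm_two,
    ← inv_div, ENNReal.ofReal_inv_of_pos (by positivity)]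
  simp

theorem sumsTo_g2 (hq0 : 0 < q) (hq1 : q < 1) (α : ℝ) :
    SumsTo (rescale ((1 - (q : ℂ)) / 2) ((expand 2 two_ne_zero
        (rescale (-1) (besselSeries (q ^ 2) ((q ^ 2) ^ (α + 1))))).map Complex.ofRealHom))
      (fun t => g2 α q (Complex.I * t)) ⊤ := by
  have hp0 : 0 < q ^ 2 := by positivity
  have hp1 : q ^ 2 < 1 := pow_lt_one₀ hq0.le hq1 two_ne_zero
  rw [map_expand, ← rescale_map]
  refine (((sumsTo_besselSeries hp0 hp1 _).rescale_top _).expand two_ne_zero).rescale_top _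
    |>.congr fun t _ => ?_
  rw [g2, modBesselJ2_eq_powerSum hp0]
  congr 1
  rw [map_neg, map_one, ← Complex.I_sq]
  ring

theorem bigEq_mul_quotient (hq0 : 0 < q) (hq1 : q < 1) (hα : -1 < α) {t : ℂ}
    (ht : ‖t‖ₑ < ENNReal.ofReal (2 / (1 - q))) :
    bigEq q (-t / 2) * powerSum (quotientSeries α q) t = g2 α q (Complex.I * t) := by
  have hprod := (((sumsTo_bigEq hq0 hq1).rescale_top (-1 / 2)).mono le_top).mul
    (sumsTo_quotientSeries hq0 hq1 hα)
  rw [rescale_mk_Psi_mul_quotientSeries hq0 hq1 hα] at hprod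
  rw [show -t / 2 = -1 / 2 * t by ring]
  exact (hprod t ht).unique (sumsTo_g2 hq0 hq1 α t enorm_lt_top)

/-- The power series `∑ B_{n,α}^{(2)}(z;q) tⁿ / [n]_q!` of the generating function in `t`. -/
noncomputable def bernoulliSeries (α q : ℝ) (z : ℂ) : ℂ⟦X⟧ :=
  mk fun n => bernoulliB2 α q n z / (qFact q n : ℂ)

theorem qFact_ne_zero (hq0 : 0 < q) (hq1 : q < 1) (n : ℕ) : qFact q n ≠ 0 := by
  have := qPoch_pos hq1 hq0 hq1 n
  have := sub_pos.2 hq1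
  rw [qFact_eq]
  positivity

theorem sumsTo_bernoulliSeries (hq0 : 0 < q) (hq1 : q < 1) (hα : -1 < α)
    (hj : IsFirstZero α q j) (z : ℂ) :
    SumsTo (bernoulliSeries α q z) (genFun α q z) (ENNReal.ofReal (j / (1 - q))) := by
  have htaylor : bernoulliSeries α q z =
      mk fun n => iteratedDeriv n (genFun α q z) 0 / (n.factorial : ℂ) := by
    ext n
    rw [bernoulliSeries, coeff_mk, coeff_mk, bernoulliB2,
      mul_div_cancel_left₀ _ (Complex.ofReal_ne_zero.2 (qFact_ne_zero hq0 hq1 n))]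
  have hE := (sumsTo_bigEq hq0 hq1).differentiable
  have hg := (sumsTo_g2 hq0 hq1 α).differentiable
  rw [htaylor]
  refine SumsTo.of_differentiableOn (DifferentiableOn.div ?_ hg.differentiableOn fun t ht =>
    g2_ne_zero hq0 hq1 hα hj (by simpa using ht))
  exact ((hE.comp (by fun_prop)).mul (hE.comp (by fun_prop))).differentiableOn

theorem bernoulliSeries_mul_quotientSeries (hq0 : 0 < q) (hq1 : q < 1) (hα : -1 < α)
    (hj : IsFirstZero α q j) (z : ℂ) :
    bernoulliSeries α q z * quotientSeries α q =
      rescale z ((mk (Psi q)).map Complex.ofRealHom) := by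
  have h1q := sub_pos.2 hq1
  have hR : 0 < min (ENNReal.ofReal (j / (1 - q))) (ENNReal.ofReal (2 / (1 - q))) :=
    lt_min (ENNReal.ofReal_pos.2 (div_pos hj.1.1 h1q)) (ENNReal.ofReal_pos.2 (by positivity))
  have hprod := ((sumsTo_bernoulliSeries hq0 hq1 hα hj z).mono (min_le_left _ _)).mul
    ((sumsTo_quotientSeries hq0 hq1 hα).mono (min_le_right _ _))
  refine (hprod.congr fun t ht => ?_).unique
    (((sumsTo_bigEq hq0 hq1).rescale_top z).mono le_top) hR
  have hne := g2_ne_zero hq0 hq1 hα hj (enorm_lt_ofReal_iff.1 (ht.trans_le (min_le_left _ _)))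
  rw [genFun, div_mul_eq_mul_div, mul_assoc,
    bigEq_mul_quotient hq0 hq1 hα (ht.trans_le (min_le_right _ _)), mul_div_cancel_right₀ _ hne]

theorem coeff_bernoulliSeries_mul_quotientSeries (hq0 : 0 < q) (hq1 : q < 1) (hα : -1 < α)
    (hj : IsFirstZero α q j) (z : ℂ) (k : ℕ) :
    coeff k (bernoulliSeries α q z * quotientSeries α q) = Psi q k * z ^ k := by
  rw [bernoulliSeries_mul_quotientSeries hq0 hq1 hα hj, coeff_rescale, coeff_map, coeff_mk,
    Complex.ofRealHom_eq_coe, mul_comm]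

end GeneratingFunction

section Expansion

variable {α q : ℝ}

theorem coeffTerm_add (hq0 : 0 < q) (hq1 : q < 1) (α : ℝ) (a : ℕ → ℂ) (n m : ℕ) :
    coeffTerm α q a n (n + m) =
      (1 - (q : ℂ)) ^ n * (a (n + m) / (Psi q (n + m) : ℂ) * coeff m (quotientSeries α q)) := by
  have h1q : 1 - q ≠ 0 := (sub_pos.2 hq1).ne'
  have hratio : (q ^ ((n + m) * (n + m - 1) / 2))⁻¹ * qPoch q q (n + m) =
      (1 - q) ^ n * (1 - q) ^ m / Psi q (n + m) := by
    have := (qPoch_pos hq1 hq0 hq1 (n + m)).ne'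
    rw [Psi_eq, ← pow_add]
    field_simp
  rw [coeffTerm, Nat.add_sub_cancel_left, hratio, quotientSeries, coeff_rescale, coeff_map,
    coeff_mk, expansionCoeff, Complex.ofRealHom_eq_coe, div_pow, div_pow]
  push_cast
  ring

theorem hasSum_coeffTerm (hq0 : 0 < q) (hq1 : q < 1) {a : ℕ → ℂ} {n : ℕ}
    (h : Summable fun m =>
      a (n + m) / (Psi q (n + m) : ℂ) * coeff m (quotientSeries α q)) :
    HasSum (fun k : Set.Ici n => coeffTerm α q a n k) ((1 - (q : ℂ)) ^ n *
      ∑' m, a (n + m) / (Psi q (n + m) : ℂ) * coeff m (quotientSeries α q)) :=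
  hasSum_Ici_iff.2 <| (h.hasSum.mul_left _).congr_fun fun m => coeffTerm_add hq0 hq1 α a n m

theorem coeffL_eq (hq0 : 0 < q) (hq1 : q < 1) {a : ℕ → ℂ} {n : ℕ}
    (h : Summable fun m =>
      a (n + m) / (Psi q (n + m) : ℂ) * coeff m (quotientSeries α q)) :
    coeffL α q a n =
      ∑' m, a (n + m) / (Psi q (n + m) : ℂ) * coeff m (quotientSeries α q) := by
  have h1q : (((1 - q) ^ n : ℝ) : ℂ) ≠ 0 :=
    Complex.ofReal_ne_zero.2 (pow_pos (sub_pos.2 hq1) n).ne'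
  rw [coeffL, (hasSum_coeffTerm hq0 hq1 h).tsum_eq]
  push_cast at h1q ⊢
  rw [inv_mul_cancel_left₀ h1q]

end Expansion

end QBernoulli

open QBernoulli

theorem theorem4p5 (q α : ℝ) (hq0 : 0 < q) (hq1 : q < 1) (hα : -1 < α)
    (j : ℝ) (hj : QBernoulli.IsFirstZero α q j)
    (f : ℂ → ℂ) (a : ℕ → ℂ) (hf : ∀ z : ℂ, HasSum (fun n : ℕ => a n * z ^ n) (f z))
    (τ : ℝ) (hτ0 : 0 ≤ τ) (hτ : τ < min (2 / (1 - q)) (j / (1 - q)))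
    (hlim : Filter.limsup
        (fun n : ℕ => ENNReal.ofReal (‖a n / (QBernoulli.Psi q n : ℂ)‖ ^ (1 / (n : ℝ))))
        Filter.atTop = ENNReal.ofReal τ) :
    (∀ n : ℕ, Summable (fun k : Set.Ici n => QBernoulli.coeffTerm α q a n k)) ∧
    ∀ z : ℂ, HasSum
      (fun n : ℕ => QBernoulli.coeffL α q a n *
        (QBernoulli.bernoulliB2 α q n z / (QBernoulli.qFact q n : ℂ)))
      (f z) := by
  obtain ⟨ρ, hτρ, hρ⟩ := exists_between hτ
  have hρ0 : 0 < ρ := hτ0.trans_lt hτρ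
  have hlt : ∀ {R : ℝ}, ρ < R → ENNReal.ofReal ρ < ENNReal.ofReal R :=
    (ENNReal.ofReal_lt_ofReal_iff_of_nonneg hρ0.le).2
  obtain ⟨C, hC⟩ := exists_norm_le_of_limsup_lt hρ0
    (hlim.trans_lt ((ENNReal.ofReal_lt_ofReal_iff hρ0).2 hτρ))
  have hD := (sumsTo_quotientSeries hq0 hq1 hα).summable_norm_mul_pow hρ0.le
    (hlt (hρ.trans_le (min_le_left _ _)))
  have hrow := summable_add_mul hC hD
  refine ⟨fun n => (hasSum_coeffTerm hq0 hq1 (hrow n)).summable, fun z => ?_⟩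
  have hB := (sumsTo_bernoulliSeries hq0 hq1 hα hj z).summable_norm_mul_pow hρ0.le
    (hlt (hρ.trans_le (min_le_right _ _)))
  refine (hasSum_tsum_add_mul hρ0.le hC hD hB ((hf z).congr_fun fun k => ?_)).congr_fun fun n => ?_
  · have hΨ : (Psi q k : ℂ) ≠ 0 := Complex.ofReal_ne_zero.2 (Psi_pos hq0 hq1 k).ne'
    rw [coeff_bernoulliSeries_mul_quotientSeries hq0 hq1 hα hj, ← mul_assoc, div_mul_cancel₀ _ hΨ]
  · rw [coeffL_eq hq0 hq1 (hrow n), bernoulliSeries, PowerSeries.coeff_mk]
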